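/- A complex Hadamard matrix is a square complex matrix whose entries have modulus $1$ and whose rows are pairwise orthogonal. For integers $n,l\ge 1$ let $H_n(l)$ be the set of $n\times n$ complex Hadamard matrices all of whose entries are $l$-th roots of unity. Say that $(n,l)$ is *obstructed* if at least one of the following holds. - (Lam–Leung) $n\ge 2$ and $n\notin p_1\mathbb N+\dots+p_s\mathbb N$, where $p_1,\dots,p_s$ are the primes dividing $l$ (the sum is $\{0\}$ if $l=1$, and $0\in\mathbb N$). - (de Launey) There is no $d\in\mathbb Z[e^{2\pi i/l}]$ with $|d|^2=n^n$. - (Haagerup) $n=5$ and $5\nmid l$. - (Sylvester) $l=2$, $n\ge 3$ and $4\nmid n$. - (Sylvester, variant A) $n=p+2$ and $l=2p^b$ for some prime $p\ge 3$ and some $b\ge 1$. - (Sylvester, variant B) $n=2q$ and $l=2p^b$ for some primes $p>q\ge 3$ and some $b\ge 1$. Write $F_n=(e^{2\pi i\,ab/n})_{0\le a,b<n}$, $F_{22}=F_2\otimes F_2$, $F_{222}=F_2\otimes F_2\otimes F_2$, $F_{33}=F_3\otimes F_3$, and let $E_l(K)$ denote the matrix with entries $e^{2\pi i K_{ab}/l}$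 for an integer matrix $K$. Put $$T=E_3\begin{pmatrix}0&0&0&0&0&0\\0&0&1&1&2&2\\0&1&0&2&2&1\\0&1&2&0&1&2\\0&2&2&1&0&1\\0&2&1&2&1&0\end{pmatrix},\quad H=\begin{pmatrix}1&1&1&1&1&1\\1&-1&i&i&-i&-i\\1&i&-1&-i&1&-1\\1&i&-i&-1&-1&1\\1&-i&1&-1&i&-1\\1&-i&-1&1&-1&i\end{pmatrix},\quad P=E_6\begin{pmatrix}0&0&0&0&0&0&0\\0&1&4&5&3&3&1\\0&4&1&3&5&3&1\\0&5&3&1&4&1&3\\0&3&5&4&1&1&3\\0&3&3&1&1&4&5\\0&1&1&3&3&5&4\end{pmatrix},$$ $$X_9^{10}=E_{10}\begin{pmatrix}0&0&0&0&0&0&0&0&0\\0&5&3&3&5&9&8&7&1\\0&4&5&7&1&3&5&9&9\\0&3&7&5&1&8&9&3&5\\0&9&1&5&5&3&7&2&7\\0&9&5&1&3&5&1&7&6\\0&1&7&9&6&1&5&5&3\\0&7&9&4&9&5&3&5&1\\0&5&2&9&7&7&3&1&5\end{pmatrix},\quad X_{10}^4=E_4\begin{pmatrix}0&0&0&0&0&0&0&0&0&0\\0&2&3&3&3&3&1&1&1&1\\0&3&2&1&1&3&3&3&1&1\\0&3&1&2&3&1&3&1&3&1\\0&3&1&3&2&1&1&3&1&3\\0&3&3&1&1&2&1&1&3&3\\0&1&3&3&1&1&2&3&3&1\\0&1&3&1&3&1&3&2&1&3\\0&1&1&3&1&3&3&1&2&3\\0&1&1&1&3&3&1&3&3&2\end{pmatrix},$$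 $$X_{10}^5=E_5\begin{pmatrix}0&0&0&0&0&0&0&0&0&0\\0&0&1&1&2&2&3&3&4&4\\0&1&0&3&2&4&1&4&2&3\\0&1&3&4&3&1&0&2&4&2\\0&2&3&0&1&3&4&1&2&4\\0&2&4&2&0&1&3&4&3&1\\0&3&1&2&4&0&4&2&1&3\\0&3&2&4&1&4&2&3&0&1\\0&4&2&1&4&3&1&0&3&2\\0&4&4&3&3&2&2&1&1&0\end{pmatrix},\quad X_{10}^6=E_6\begin{pmatrix}0&0&0&0&0&0&0&0&0&0\\0&4&1&5&3&1&3&3&5&1\\0&1&2&3&5&5&1&3&5&3\\0&5&3&2&1&5&3&5&3&1\\0&3&5&1&4&1&1&5&3&3\\0&3&3&3&3&3&0&0&0&0\\0&1&1&5&3&4&3&0&2&4\\0&1&5&3&5&2&4&3&2&0\\0&5&3&5&1&2&0&2&3&4\\0&3&5&1&1&4&4&2&0&3\end{pmatrix}.$$ For $1\le n\le 10$ and $1\le l\le 14$, the listed matrix $X_n^l$ at position $(n,l)$ is the following (where several conditions hold in a line, the first one counts; where none holds, no matrix is listed): - $n=1$: $F_1$. $\;n=2$: $F_2$ if $2\mid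 l$. $\;n=3$: $F_3$ if $3\mid l$. $\;n=4$: $F_{22}$ if $2\mid l$. $\;n=5$: $F_5$ if $5\mid l$. - $n=6$: $T$ if $3\mid l$; $H$ if $4\mid l$. - $n=7$: $P$ if $6\mid l$; $F_7$ if $7\mid l$. - $n=8$: $F_{222}$ if $2\mid l$. - $n=9$: $F_{33}$ if $3\mid l$; $X_9^{10}$ if $l=10$. - $n=10$: $X_{10}^4$ if $4\mid l$; $X_{10}^5$ if $l=5$; $X_{10}^6$ if $l=6$; $F_{10}$ if $l=10$. **Theorem.** For all integers $1\le n\le 10$ and $1\le l\le 14$, one of the following happens: 1. a matrix $X_n^l$ is listed at position $(n,l)$, and $X_n^l\in H_n(l)$; 2. $H_n(l)=\emptyset$, and $(n,l)$ is obstructed. Moreover, in this range $H_n(l)=\emptyset$ whenever $(n,l)$ is obstructed. -/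

import Mathlib

open scoped Matrix

namespace Butson

noncomputable section

/-- The root of unity `exp (2 π i / m)`. -/
def zeta (m : ℕ) : ℂ := Complex.exp (2 * Real.pi * Complex.I / m)

/-- A complex Hadamard matrix: entries on the unit circle, rows pairwise orthogonal. -/
def IsComplexHadamard {n : ℕ} (h : Matrix (Fin n) (Fin n) ℂ) : Prop :=
  (∀ i j, ‖h i j‖ = 1) ∧ ∀ i k, i ≠ k → h i ⬝ᵥ star (h k) = 0

/-- The Butson class `H_n(l)`: complex Hadamard matrices of size `n` whose entries are
`l`-th roots of unity (`l ≥ 1`). -/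
def H (n l : ℕ) : Set (Matrix (Fin n) (Fin n) ℂ) :=
  {h | IsComplexHadamard h ∧ ∀ i j, h i j ^ l = 1}

/-! ### The explicit matrices -/

/-- The Fourier matrix; with indices starting at `0` its entries are `w ^ (i * j)`. -/
def F (n : ℕ) : Matrix (Fin n) (Fin n) ℂ :=
  Matrix.of fun i j => zeta n ^ ((i : ℕ) * (j : ℕ))

/-- The tensor product of two matrices, with the usual lexicographic identification of indices. -/
def tensor {m n : ℕ} (A : Matrix (Fin m) (Fin m) ℂ) (B : Matrix (Fin n) (Fin n) ℂ) :
    Matrix (Fin (m * n)) (Fin (m * n)) ℂ :=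
  Matrix.reindex finProdFinEquiv finProdFinEquiv (Matrix.kroneckerMap (· * ·) A B)

def F22 : Matrix (Fin 4) (Fin 4) ℂ := tensor (F 2) (F 2)

def F222 : Matrix (Fin 8) (Fin 8) ℂ := tensor (tensor (F 2) (F 2)) (F 2)

def F33 : Matrix (Fin 9) (Fin 9) ℂ := tensor (F 3) (F 3)

/-- The Tao matrix, `j = exp (2 π i / 3)`. -/
def tao : Matrix (Fin 6) (Fin 6) ℂ :=
  let j := zeta 3
  !![1, 1, 1, 1, 1, 1;
     1, 1, j, j, j ^ 2, j ^ 2;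
     1, j, 1, j ^ 2, j ^ 2, j;
     1, j, j ^ 2, 1, j, j ^ 2;
     1, j ^ 2, j ^ 2, j, 1, j;
     1, j ^ 2, j, j ^ 2, j, 1]

/-- The Haagerup matrix at parameter `q = 1`. -/
def haagerup : Matrix (Fin 6) (Fin 6) ℂ :=
  let i := Complex.I
  !![1, 1, 1, 1, 1, 1;
     1, -1, i, i, -i, -i;
     1, i, -1, -i, 1, -1;
     1, i, -i, -1, -1, 1;
     1, -i, 1, -1, i, -1;
     1, -i, -1, 1, -1, i]

/-- The Petrescu matrix at parameter `q = 1`, with `w = exp (2 π i / 6)`. -/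
def petrescu : Matrix (Fin 7) (Fin 7) ℂ :=
  let w := zeta 6
  !![1, 1, 1, 1, 1, 1, 1;
     1, w, w ^ 4, w ^ 5, w ^ 3, w ^ 3, w;
     1, w ^ 4, w, w ^ 3, w ^ 5, w ^ 3, w;
     1, w ^ 5, w ^ 3, w, w ^ 4, w, w ^ 3;
     1, w ^ 3, w ^ 5, w ^ 4, w, w, w ^ 3;
     1, w ^ 3, w ^ 3, w, w, w ^ 4, w ^ 5;
     1, w, w, w ^ 3, w ^ 3, w ^ 5, w ^ 4]

/-- Logarithmic notation at level `l`: the exponent `k` stands for `exp (2 π i k / l)`. -/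
def ofLog {n : ℕ} (l : ℕ) (k : Matrix (Fin n) (Fin n) ℕ) : Matrix (Fin n) (Fin n) ℂ :=
  Matrix.of fun i j => zeta l ^ k i j

def X9_10 : Matrix (Fin 9) (Fin 9) ℂ := ofLog 10
  !![0, 0, 0, 0, 0, 0, 0, 0, 0;
     0, 5, 3, 3, 5, 9, 8, 7, 1;
     0, 4, 5, 7, 1, 3, 5, 9, 9;
     0, 3, 7, 5, 1, 8, 9, 3, 5;
     0, 9, 1, 5, 5, 3, 7, 2, 7;
     0, 9, 5, 1, 3, 5, 1, 7, 6;
     0, 1, 7, 9, 6, 1, 5, 5, 3;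
     0, 7, 9, 4, 9, 5, 3, 5, 1;
     0, 5, 2, 9, 7, 7, 3, 1, 5]

def X10_4 : Matrix (Fin 10) (Fin 10) ℂ := ofLog 4
  !![0, 0, 0, 0, 0, 0, 0, 0, 0, 0;
     0, 2, 3, 3, 3, 3, 1, 1, 1, 1;
     0, 3, 2, 1, 1, 3, 3, 3, 1, 1;
     0, 3, 1, 2, 3, 1, 3, 1, 3, 1;
     0, 3, 1, 3, 2, 1, 1, 3, 1, 3;
     0, 3, 3, 1, 1, 2, 1, 1, 3, 3;
     0, 1, 3, 3, 1, 1, 2, 3, 3, 1;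
     0, 1, 3, 1, 3, 1, 3, 2, 1, 3;
     0, 1, 1, 3, 1, 3, 3, 1, 2, 3;
     0, 1, 1, 1, 3, 3, 1, 3, 3, 2]

def X10_5 : Matrix (Fin 10) (Fin 10) ℂ := ofLog 5
  !![0, 0, 0, 0, 0, 0, 0, 0, 0, 0;
     0, 0, 1, 1, 2, 2, 3, 3, 4, 4;
     0, 1, 0, 3, 2, 4, 1, 4, 2, 3;
     0, 1, 3, 4, 3, 1, 0, 2, 4, 2;
     0, 2, 3, 0, 1, 3, 4, 1, 2, 4;
     0, 2, 4, 2, 0, 1, 3, 4, 3, 1;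
     0, 3, 1, 2, 4, 0, 4, 2, 1, 3;
     0, 3, 2, 4, 1, 4, 2, 3, 0, 1;
     0, 4, 2, 1, 4, 3, 1, 0, 3, 2;
     0, 4, 4, 3, 3, 2, 2, 1, 1, 0]

def X10_6 : Matrix (Fin 10) (Fin 10) ℂ := ofLog 6
  !![0, 0, 0, 0, 0, 0, 0, 0, 0, 0;
     0, 4, 1, 5, 3, 1, 3, 3, 5, 1;
     0, 1, 2, 3, 5, 5, 1, 3, 5, 3;
     0, 5, 3, 2, 1, 5, 3, 5, 3, 1;
     0, 3, 5, 1, 4, 1, 1, 5, 3, 3;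
     0, 3, 3, 3, 3, 3, 0, 0, 0, 0;
     0, 1, 1, 5, 3, 4, 3, 0, 2, 4;
     0, 1, 5, 3, 5, 2, 4, 3, 2, 0;
     0, 5, 3, 5, 1, 2, 0, 2, 3, 4;
     0, 3, 5, 1, 1, 4, 4, 2, 0, 3]

/-- The explicit matrix listed at position `(n, l)` of the table (`1 ≤ n ≤ 10`, `1 ≤ l ≤ 14`),
or `none` when the table lists an obstruction there. -/
def explicitExample : (n l : ℕ) → Option (Matrix (Fin n) (Fin n) ℂ)
  | 1, _ => some (F 1)
  | 2, l => if 2 ∣ l then some (F 2) else none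
  | 3, l => if 3 ∣ l then some (F 3) else none
  | 4, l => if 2 ∣ l then some F22 else none
  | 5, l => if 5 ∣ l then some (F 5) else none
  | 6, l => if 3 ∣ l then some tao else if 4 ∣ l then some haagerup else none
  | 7, l => if 6 ∣ l then some petrescu else if 7 ∣ l then some (F 7) else none
  | 8, l => if 2 ∣ l then some F222 else none
  | 9, l => if 3 ∣ l then some F33 else if l = 10 then some X9_10 else none
  | 10, l =>
      if 4 ∣ l then some X10_4 else if l = 5 then some X10_5
      else if l = 6 then some X10_6 else if l = 10 then some (F 10) else none
  | _, _ => none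

/-! ### The obstructions -/

/-- `n` is not in `p₁ ℕ + ⋯ + p_s ℕ`, where `p₁, …, p_s` are the primes dividing `l`.
This comes from the orthogonality of two distinct rows, so it concerns `n ≥ 2` only. -/
def LamLeungObstruction (n l : ℕ) : Prop :=
  2 ≤ n ∧ n ∉ AddSubmonoid.closure {p : ℕ | p.Prime ∧ p ∣ l}

/-- No `d` in the ring `ℤ[exp (2 π i / l)]` satisfies `|d|² = n ^ n`. -/
def DeLauneyObstruction (n l : ℕ) : Prop :=
  ¬ ∃ d ∈ Algebra.adjoin ℤ {zeta l}, ‖d‖ ^ 2 = (n : ℝ) ^ n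

def HaagerupObstruction (n l : ℕ) : Prop :=
  n = 5 ∧ ¬ 5 ∣ l

/-- The obstruction for real Hadamard matrices (`l = 2`); it comes from the orthogonality of
rows, so it concerns `n ≥ 2` only. -/
def SylvesterObstruction (n l : ℕ) : Prop :=
  l = 2 ∧ 2 ≤ n ∧ n ≠ 2 ∧ ¬ 4 ∣ n

/-- First variant of the Sylvester obstruction: `n = p + 2` and `l = 2 p ^ b`. -/
def SylvesterObstructionA (n l : ℕ) : Prop :=
  ∃ p b : ℕ, p.Prime ∧ 3 ≤ p ∧ 1 ≤ b ∧ n = p + 2 ∧ l = 2 * p ^ b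

/-- Second variant of the Sylvester obstruction: `n = 2 q` and `l = 2 p ^ b` with primes
`p > q ≥ 3`. -/
def SylvesterObstructionB (n l : ℕ) : Prop :=
  ∃ p q b : ℕ, p.Prime ∧ q.Prime ∧ 3 ≤ q ∧ q < p ∧ 1 ≤ b ∧ n = 2 * q ∧ l = 2 * p ^ b

/-- One of the obstructions applies to the pair `(n, l)`. -/
def Obstructed (n l : ℕ) : Prop :=
  LamLeungObstruction n l ∨ DeLauneyObstruction n l ∨ HaagerupObstruction n l ∨
    SylvesterObstruction n l ∨ SylvesterObstructionA n l ∨ SylvesterObstructionB n l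

end

end Butson

/-!
# Butson matrices of size at most 10 and level at most 14

Emptiness of `H n l` is obtained by forgetting part of the roots of unity.  If a sum of signed roots
of unity of order dividing a prime power `p ^ (b + 1)` vanishes, then the sum of the signs is
divisible by `p`, because `Φ(1) = p` for the cyclotomic polynomial of that index
(`dvd_sum_of_sum_mul_eq_zero`).  For prime powers `l` this gives `p ∣ n`.  For `l = 2 p ^ b` it shows
that the signs of the entries form a matrix whose rows have scalar products divisible by `p`
(`exists_signs`); parity and size then determine these scalar products, and Sylvester's argument with
three rows (`sylvester_sum`) excludes both variants of his obstruction.  The obstruction of de Launey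
is the determinant.

The exclusion of `n = 5` reduces to `l = 12`, the other levels falling under the Lam-Leung argument.
Write the entries as `I ^ a * ω ^ b` with `ω ^ 3 = 1`.  A vanishing sum of five such terms forces
`∑ I ^ a` to be divisible by `3` in the Gaussian integers, so that up to a common factor the values
`I ^ a` are `1, 1, 1, 1, -1` or `1, 1, 1, I, -I`; comparing the rows relative to the first one leaves
only the second shape, with all pairs `I, -I` having one column in common.  In that case the two
places of a pair carry the same exponent `b`, the other three carry distinct ones, and sums of these
exponents modulo `3` give a contradiction (`not_pairTriple_star`, `H_five_twelve_eq_empty`).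

The listed matrices are Fourier matrices, tensor products of them, or given by exponents.  For the
latter, `∑ ζ ^ e j = 0` follows from the vanishing of `(1 - ζ ^ u) * (1 - ζ ^ v) * ∑ ζ ^ e j`, whose
coefficients are second differences of the numbers of occurrences of the exponents
(`sum_stdAddChar_eq_zero`, `ofLog_mem_H`).
-/

open scoped Matrix

namespace Butson

/-! ### Entries of Butson matrices -/

theorem isPrimitiveRoot_zeta {l : ℕ} (hl : l ≠ 0) : IsPrimitiveRoot (zeta l) l :=
  Complex.isPrimitiveRoot_exp l hl

theorem H_mono {n l m : ℕ} (hlm : l ∣ m) : H n l ⊆ H n m := by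
  rintro h ⟨hH, hl⟩
  refine ⟨hH, fun i j => ?_⟩
  obtain ⟨c, rfl⟩ := hlm
  rw [pow_mul, hl, one_pow]

theorem mul_star_pow {n l : ℕ} {h : Matrix (Fin n) (Fin n) ℂ} (hh : h ∈ H n l) (i k j : Fin n) :
    (h i j * star (h k j)) ^ l = 1 := by
  rw [mul_pow, ← star_pow, hh.2, hh.2, star_one, one_mul]

theorem sum_mul_star {n l : ℕ} {h : Matrix (Fin n) (Fin n) ℂ} (hh : h ∈ H n l) {i k : Fin n}
    (hik : i ≠ k) : ∑ j, h i j * star (h k j) = 0 := hh.1.2 i k hik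

/-! ### Additive characters of `ZMod l` -/

theorem stdAddChar_one (N : ℕ) [NeZero N] : ZMod.stdAddChar (1 : ZMod N) = zeta N := by
  have := ZMod.stdAddChar_coe (N := N) 1
  simp only [Int.cast_one, mul_one] at this
  rw [this, zeta]

theorem stdAddChar_natCast (N : ℕ) [NeZero N] (k : ℕ) :
    ZMod.stdAddChar (k : ZMod N) = zeta N ^ k := by
  rw [← stdAddChar_one, ← AddChar.map_nsmul_eq_pow, nsmul_one]

theorem stdAddChar_mul_star {N : ℕ} [NeZero N] (a b : ZMod N) :
    (ZMod.stdAddChar a * star (ZMod.stdAddChar b) : ℂ) = ZMod.stdAddChar (a - b) := by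
  rw [sub_eq_add_neg, AddChar.map_add_eq_mul, AddChar.map_neg_eq_conj, starRingEnd_apply]

theorem zeta_four : zeta 4 = Complex.I := by
  have h : (2 * Real.pi * Complex.I / (4 : ℕ) : ℂ) = Real.pi / 2 * Complex.I := by
    push_cast; ring
  rw [zeta, h, Complex.exp_pi_div_two_mul_I]

/-! ### Vanishing sums of roots of unity of prime power order -/

/-- The cyclotomic polynomial `Φ` of index `p ^ (b + 1)` divides any integer polynomial that vanishes
at a primitive root of unity of that order, and `Φ(1) = p`. -/
theorem dvd_sum_of_sum_mul_eq_zero {ι : Type*} [Fintype ι] {p b : ℕ} (hp : p.Prime)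
    (ε : ι → ℤ) (z : ι → ℂ) (hz : ∀ j, z j ^ p ^ (b + 1) = 1) (h0 : ∑ j, (ε j : ℂ) * z j = 0) :
    (p : ℤ) ∣ ∑ j, ε j := by
  have : Fact p.Prime := ⟨hp⟩
  have hpos : 0 < p ^ (b + 1) := pow_pos hp.pos _
  have : NeZero (p ^ (b + 1)) := ⟨hpos.ne'⟩
  have hζ := isPrimitiveRoot_zeta hpos.ne'
  choose k _ hk using fun j => hζ.eq_pow_of_pow_eq_one (hz j)
  let f : Polynomial ℤ := ∑ j, Polynomial.C (ε j) * Polynomial.X ^ k j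
  have hf : Polynomial.aeval (zeta (p ^ (b + 1))) f = 0 := by
    simp only [f, map_sum, map_mul, Polynomial.aeval_C, map_pow, Polynomial.aeval_X, hk]
    simpa using h0
  have hdvd := minpoly.isIntegrallyClosed_dvd (hζ.isIntegral hpos) hf
  rw [← Polynomial.cyclotomic_eq_minpoly hζ hpos] at hdvd
  have h1 := Polynomial.eval_dvd (x := 1) hdvd
  rw [Polynomial.eval_one_cyclotomic_prime_pow] at h1
  simpa [f, Polynomial.eval_finsetSum] using h1

theorem H_eq_empty_of_one {n : ℕ} (hn : 2 ≤ n) : H n 1 = ∅ := by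
  refine Set.eq_empty_of_forall_notMem fun h hh => ?_
  have h0 := sum_mul_star hh (i := ⟨0, by omega⟩) (k := ⟨1, by omega⟩) (by simp)
  have h1 : ∀ i j, h i j = 1 := fun i j => by simpa using hh.2 i j
  simp only [h1, star_one, mul_one, Finset.sum_const, Finset.card_univ, Fintype.card_fin,
    nsmul_eq_mul, Nat.cast_eq_zero] at h0
  omega

theorem H_eq_empty_of_prime_pow {n p b : ℕ} (hn : 2 ≤ n) (hp : p.Prime) (hpn : ¬ p ∣ n) :
    H n (p ^ (b + 1)) = ∅ := by
  refine Set.eq_empty_of_forall_notMem fun h hh => hpn ?_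
  have h0 := sum_mul_star hh (i := ⟨0, by omega⟩) (k := ⟨1, by omega⟩) (by simp)
  have := dvd_sum_of_sum_mul_eq_zero hp (fun _ : Fin n => 1) _ (mul_star_pow hh _ _)
    (by simpa using h0)
  simpa [Int.natCast_dvd_natCast] using this

/-! ### Sign matrices -/

/-- For `p` odd, a root of unity of order dividing `2 p ^ b` is a sign times a root of order
dividing `p ^ b`.  The signs of the entries of a matrix in `H n (2 p ^ b)` have scalar products
divisible by `p`. -/
theorem exists_signs {n p b : ℕ} {h : Matrix (Fin n) (Fin n) ℂ} (hp : p.Prime) (hp3 : 3 ≤ p)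
    (hh : h ∈ H n (2 * p ^ (b + 1))) :
    ∃ s : Fin n → Fin n → ℤ, (∀ i j, s i j = 1 ∨ s i j = -1) ∧
      ∀ i k, i ≠ k → (p : ℤ) ∣ ∑ j, s i j * s k j := by
  have hodd : Odd (p ^ (b + 1)) := (hp.odd_of_ne_two (by omega)).pow
  have hs : ∀ i j, ∃ s : ℤ, (s = 1 ∨ s = -1) ∧ ((s : ℂ) * h i j) ^ p ^ (b + 1) = 1 := by
    intro i j
    have h2 : (h i j ^ p ^ (b + 1)) ^ 2 = 1 := by rw [← pow_mul, mul_comm]; exact hh.2 i j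
    rcases mul_self_eq_one_iff.mp ((sq _).symm.trans h2) with h1 | h1
    · exact ⟨1, Or.inl rfl, by simpa using h1⟩
    · exact ⟨-1, Or.inr rfl, by simp [hodd.neg_pow, h1]⟩
  choose s hs1 hs2 using hs
  refine ⟨s, hs1, fun i k hik => ?_⟩
  refine dvd_sum_of_sum_mul_eq_zero hp (b := b) _
    (fun j => ((s i j : ℂ) * h i j) * star ((s k j : ℂ) * h k j)) (fun j => ?_) ?_
  · rw [mul_pow, ← star_pow, hs2, hs2, star_one, one_mul]
  · rw [← sum_mul_star hh hik]
    refine Finset.sum_congr rfl fun j _ => ?_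
    rcases hs1 i j with h1 | h1 <;> rcases hs1 k j with h2 | h2 <;> simp [h1, h2]

theorem abs_sum_le_of_signs {n : ℕ} {s : Fin n → ℤ} (hs : ∀ j, s j = 1 ∨ s j = -1) :
    |∑ j, s j| ≤ n := by
  refine (Finset.abs_sum_le_sum_abs _ _).trans (le_of_eq ?_)
  have : ∀ j, |s j| = 1 := fun j => by rcases hs j with h | h <;> simp [h]
  simp [this]

theorem two_dvd_card_sub_sum_of_signs {n : ℕ} {s : Fin n → ℤ} (hs : ∀ j, s j = 1 ∨ s j = -1) :
    (2 : ℤ) ∣ n - ∑ j, s j := by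
  have : (n : ℤ) - ∑ j, s j = ∑ j, (1 - s j) := by simp
  rw [this]
  refine Finset.dvd_sum fun j _ => ?_
  rcases hs j with h | h <;> simp [h]

theorem mul_signs {x y : ℤ} (hx : x = 1 ∨ x = -1) (hy : y = 1 ∨ y = -1) :
    x * y = 1 ∨ x * y = -1 := by
  rcases hx with rfl | rfl <;> rcases hy with rfl | rfl <;> simp

/-- Sylvester's argument: with `x`, `y`, `z` sign vectors, `⟨x + y, x + z⟩` is a sum of terms
`0` and `4`. -/
theorem sylvester_sum {n : ℕ} {x y z : Fin n → ℤ} (hx : ∀ j, x j = 1 ∨ x j = -1)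
    (hy : ∀ j, y j = 1 ∨ y j = -1) (hz : ∀ j, z j = 1 ∨ z j = -1) :
    4 ∣ n + ∑ j, x j * y j + ∑ j, x j * z j + ∑ j, y j * z j ∧
      0 ≤ n + ∑ j, x j * y j + ∑ j, x j * z j + ∑ j, y j * z j := by
  have key : n + ∑ j, x j * y j + ∑ j, x j * z j + ∑ j, y j * z j =
      ∑ j, (1 + x j * y j + x j * z j + y j * z j) := by
    simp [Finset.sum_add_distrib]
  rw [key]
  constructor
  · refine Finset.dvd_sum fun j _ => ?_
    rcases hx j with h | h <;> rcases hy j with h' | h' <;> rcases hz j with h'' | h'' <;>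
      norm_num [h, h', h'']
  · refine Finset.sum_nonneg fun j _ => ?_
    rcases hx j with h | h <;> rcases hy j with h' | h' <;> rcases hz j with h'' | h'' <;>
      norm_num [h, h', h'']

theorem four_dvd_of_orthogonal_signs {n : ℕ} {s : Fin n → Fin n → ℤ} (hn : 3 ≤ n)
    (hs : ∀ i j, s i j = 1 ∨ s i j = -1) (h0 : ∀ i k, i ≠ k → ∑ j, s i j * s k j = 0) :
    4 ∣ n := by
  have h := (sylvester_sum (hs ⟨0, by omega⟩) (hs ⟨1, by omega⟩) (hs ⟨2, by omega⟩)).1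
  rw [h0 _ _ (by simp), h0 _ _ (by simp), h0 _ _ (by simp)] at h
  omega

/-! ### Emptiness for the Sylvester type obstructions -/

theorem H_eq_empty_of_sylvester {n l : ℕ} (h : SylvesterObstruction n l) : H n l = ∅ := by
  obtain ⟨rfl, h2, hn2, h4⟩ := h
  refine Set.eq_empty_of_forall_notMem fun h hh => h4 ?_
  have hs : ∀ i j, ∃ s : ℤ, (s = 1 ∨ s = -1) ∧ h i j = s := fun i j => by
    rcases mul_self_eq_one_iff.mp ((sq _).symm.trans (hh.2 i j)) with h1 | h1
    · exact ⟨1, Or.inl rfl, by simpa using h1⟩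
    · exact ⟨-1, Or.inr rfl, by simpa using h1⟩
  choose s hs1 hs2 using hs
  refine four_dvd_of_orthogonal_signs (by omega) hs1 fun i k hik => ?_
  have h0 := sum_mul_star hh hik
  simp only [hs2] at h0
  have h1 : ((∑ j, s i j * s k j : ℤ) : ℂ) = 0 := by
    rw [← h0]; simp
  exact_mod_cast h1

/-- The scalar product of two rows of signs is odd, divisible by `p`, and smaller than `p`. -/
theorem H_eq_empty_of_odd_of_lt {n p b : ℕ} (hn : 2 ≤ n) (hp : p.Prime) (hodd : ¬ 2 ∣ n)
    (hnp : n < p) : H n (2 * p ^ (b + 1)) = ∅ := by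
  refine Set.eq_empty_of_forall_notMem fun h hh => ?_
  obtain ⟨s, hs, hdvd⟩ := exists_signs hp (by omega) hh
  have hne : (⟨0, by omega⟩ : Fin n) ≠ ⟨1, by omega⟩ := by simp
  have hss := fun j => mul_signs (hs ⟨0, by omega⟩ j) (hs ⟨1, by omega⟩ j)
  have h1 := abs_sum_le_of_signs hss
  have h2 := two_dvd_card_sub_sum_of_signs hss
  have h3 := Int.eq_zero_of_abs_lt_dvd (hdvd _ _ hne) (by omega)
  omega

/-- After changes of signs, `sylvester_sum` for the first three rows of signs is a number that is
either negative or congruent to `2` modulo `4`. -/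
theorem H_eq_empty_of_sylvesterA {n l : ℕ} (h : SylvesterObstructionA n l) : H n l = ∅ := by
  obtain ⟨p, b, hp, hp3, hb, rfl, rfl⟩ := h
  obtain ⟨b, rfl⟩ := Nat.exists_eq_add_of_le' hb
  refine Set.eq_empty_of_forall_notMem fun h hh => ?_
  obtain ⟨s, hs, hdvd⟩ := exists_signs hp hp3 hh
  have hodd := hp.odd_of_ne_two (by omega)
  -- The scalar products are odd multiples of `p` of absolute value at most `p + 2`.
  have hval : ∀ i k, i ≠ k → ∑ j, s i j * s k j = p ∨ ∑ j, s i j * s k j = -p := by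
    intro i k hik
    have h1 := abs_sum_le_of_signs (fun j => mul_signs (hs i j) (hs k j))
    have h2 := two_dvd_card_sub_sum_of_signs (fun j => mul_signs (hs i j) (hs k j))
    obtain ⟨c, hc⟩ := hdvd i k hik
    rw [hc] at h1 h2 ⊢
    rw [abs_le] at h1
    push_cast at h1 h2
    obtain ⟨m, rfl⟩ := hodd
    push_cast at *
    have hm : 1 ≤ m := by omega
    have hc1 : -2 < c := by nlinarith
    have hc2 : c < 2 := by nlinarith
    have : c = -1 ∨ c = 0 ∨ c = 1 := by omega
    rcases this with rfl | rfl | rfl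
    · right; ring
    · omega
    · left; ring
  -- Changing signs of two rows gives both of them scalar product `-p` with the first row.
  have hflip : ∀ k, (0 : Fin (p + 2)) ≠ k → ∃ e : ℤ, (e = 1 ∨ e = -1) ∧
      ∑ j, s 0 j * (e * s k j) = -p := by
    intro k hk
    rcases hval 0 k hk with h1 | h1
    · exact ⟨-1, Or.inr rfl, by simp [h1]⟩
    · exact ⟨1, Or.inl rfl, by simp [h1]⟩
  obtain ⟨e, he, hes⟩ := hflip ⟨1, by omega⟩ (by simp)
  obtain ⟨f, hf, hfs⟩ := hflip ⟨2, by omega⟩ (by simp)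
  have h1 := sylvester_sum (hs 0) (fun j => mul_signs he (hs ⟨1, by omega⟩ j))
    (fun j => mul_signs hf (hs ⟨2, by omega⟩ j))
  rw [hes, hfs] at h1
  have h2 : ∑ j, e * s ⟨1, by omega⟩ j * (f * s ⟨2, by omega⟩ j) =
      e * f * ∑ j, s ⟨1, by omega⟩ j * s ⟨2, by omega⟩ j := by
    rw [Finset.mul_sum]; exact Finset.sum_congr rfl fun j _ => by ring
  rw [h2] at h1
  rcases hval ⟨1, by omega⟩ ⟨2, by omega⟩ (by simp) with h3 | h3 <;> rw [h3] at h1 <;>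
    rcases mul_signs he hf with h4 | h4 <;> rw [h4] at h1 <;> push_cast at h1 <;> omega

/-- Here the scalar products of the rows of signs are divisible by `2 p` and at most `2 q`, so the
signs form a real Hadamard matrix of order `2 q`. -/
theorem H_eq_empty_of_sylvesterB {n l : ℕ} (h : SylvesterObstructionB n l) : H n l = ∅ := by
  obtain ⟨p, q, b, hp, hq, hq3, hqp, hb, rfl, rfl⟩ := h
  obtain ⟨b, rfl⟩ := Nat.exists_eq_add_of_le' hb
  refine Set.eq_empty_of_forall_notMem fun h hh => ?_
  obtain ⟨s, hs, hdvd⟩ := exists_signs hp (by omega) hh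
  have hoddq := hq.odd_of_ne_two (by omega)
  have hcop : IsCoprime (2 : ℤ) p := by
    have := (Nat.coprime_primes Nat.prime_two hp).2 (by omega)
    exact_mod_cast Nat.isCoprime_iff_coprime.2 this
  have h4 : 4 ∣ 2 * q := by
    refine four_dvd_of_orthogonal_signs (by omega) hs fun i k hik => ?_
    have h1 := abs_sum_le_of_signs (fun j => mul_signs (hs i j) (hs k j))
    have h2 := two_dvd_card_sub_sum_of_signs (fun j => mul_signs (hs i j) (hs k j))
    push_cast at h1 h2
    refine Int.eq_zero_of_abs_lt_dvd (hcop.mul_dvd (by omega) (hdvd i k hik)) (by omega)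
  obtain ⟨m, rfl⟩ := hoddq
  omega

/-! ### Emptiness for the determinant obstruction -/

/-- The determinant of a matrix in `H n l` is a number `d` as in the obstruction. -/
theorem H_eq_empty_of_deLauney {n l : ℕ} (hl : l ≠ 0) (h : DeLauneyObstruction n l) :
    H n l = ∅ := by
  refine Set.eq_empty_of_forall_notMem fun h' hh => h ⟨h'.det, ?_, ?_⟩
  · rw [Matrix.det_apply']
    refine Subalgebra.sum_mem _ fun σ _ => Subalgebra.mul_mem _ ?_
      (Subalgebra.prod_mem _ fun i _ => ?_)
    · exact intCast_mem _ _
    · have : NeZero l := ⟨hl⟩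
      obtain ⟨k, _, hk⟩ := (isPrimitiveRoot_zeta hl).eq_pow_of_pow_eq_one (hh.2 (σ i) i)
      rw [← hk]
      exact Subalgebra.pow_mem _ (Algebra.subset_adjoin (Set.mem_singleton _)) _
  · have hmul : h' * h'ᴴ = (n : ℂ) • 1 := by
      ext i k
      rw [Matrix.mul_apply]
      rcases eq_or_ne i k with rfl | hik
      · have : ∀ j, h' i j * star (h' i j) = 1 := fun j => by
          have := Complex.mul_conj (h' i j)
          rw [Complex.normSq_eq_norm_sq, hh.1.1] at this
          simpa using this
        simp only [Matrix.conjTranspose_apply, this]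
        simp
      · simp only [Matrix.conjTranspose_apply]
        rw [sum_mul_star hh hik]; simp [hik]
    have := congrArg (fun M => ‖Matrix.det M‖) hmul
    simp only [Matrix.det_mul, Matrix.det_conjTranspose, Matrix.det_smul, norm_mul, norm_star,
      Matrix.det_one, norm_pow, Fintype.card_fin, mul_one, Complex.norm_natCast] at this
    rw [sq, this]

/-! ### Five roots of unity of order dividing 12 -/

/-- Over `ℤ`, the numbers `1`, `I`, `ω`, `I ω` with `ω = exp (2 π i / 3)` are linearly
independent. -/
theorem eq_zero_of_gaussian_add_gaussian_mul_zeta {α β γ δ : ℤ}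
    (h : (α : ℂ) + β * Complex.I + (γ + δ * Complex.I) * zeta 3 = 0) :
    α = 0 ∧ β = 0 ∧ γ = 0 ∧ δ = 0 := by
  have h3 : zeta 3 = -1 / 2 + (√3 / 2 : ℝ) * Complex.I := by
    have : (2 * Real.pi * Complex.I / (3 : ℕ) : ℂ) = ((2 * Real.pi / 3 : ℝ) : ℂ) * Complex.I := by
      push_cast; ring
    rw [zeta, this, Complex.exp_mul_I, ← Complex.ofReal_cos, ← Complex.ofReal_sin]
    have : 2 * Real.pi / 3 = Real.pi - Real.pi / 3 := by ring
    rw [this, Real.cos_pi_sub, Real.sin_pi_sub, Real.cos_pi_div_three, Real.sin_pi_div_three]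
    push_cast; ring
  have hirr : ∀ a b : ℤ, (a : ℝ) + b * √3 = 0 → a = 0 ∧ b = 0 := by
    intro a b hab
    have hI : Irrational √3 := by simpa using Nat.prime_three.irrational_sqrt
    have hb : b = 0 := by
      by_contra hb
      exact (hI.intCast_mul hb).intCast_add a |>.ne_zero hab
    subst hb
    simpa using hab
  rw [h3] at h
  have hre := congrArg Complex.re h
  have him := congrArg Complex.im h
  simp at hre him
  obtain ⟨h1, h2⟩ := hirr (2 * α - γ) (-δ) (by push_cast; linarith)
  obtain ⟨h4, h5⟩ := hirr (2 * β - δ) γ (by push_cast; linarith)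
  omega

/-- Real part of `I ^ a`. -/
def reI (a : ZMod 4) : ℤ := (![1, 0, -1, 0] : Fin 4 → ℤ) a

/-- Imaginary part of `I ^ a`. -/
def imI (a : ZMod 4) : ℤ := (![0, 1, 0, -1] : Fin 4 → ℤ) a

/-- The coefficient of `1` in `ω ^ b = r + s ω`, where `ω = exp (2 π i / 3)`. -/
def constOmega (b : ZMod 3) : ℤ := (![1, 0, -1] : Fin 3 → ℤ) b

/-- The coefficient of `ω` in `ω ^ b = r + s ω`, where `ω = exp (2 π i / 3)`. -/
def linOmega (b : ZMod 3) : ℤ := (![0, 1, -1] : Fin 3 → ℤ) b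

theorem zeta_three_sq : zeta 3 ^ 2 = -1 - zeta 3 := by
  have h := (isPrimitiveRoot_zeta (l := 3) (by norm_num)).geom_sum_eq_zero (by norm_num)
  simp [Finset.sum_range_succ] at h
  linear_combination h

theorem stdAddChar_four (a : ZMod 4) :
    ZMod.stdAddChar a = (reI a : ℂ) + imI a * Complex.I := by
  obtain ⟨k, hk, rfl⟩ : ∃ k : ℕ, k < 4 ∧ (k : ZMod 4) = a := ⟨a.val, a.val_lt, by simp⟩
  rw [stdAddChar_natCast, zeta_four]
  interval_cases k
  · simp [reI, imI]
  · have h1 : reI ((1 : ℕ) : ZMod 4) = 0 := by decide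
    have h2 : imI ((1 : ℕ) : ZMod 4) = 1 := by decide
    rw [h1, h2]; simp
  · have h1 : reI ((2 : ℕ) : ZMod 4) = -1 := by decide
    have h2 : imI ((2 : ℕ) : ZMod 4) = 0 := by decide
    rw [h1, h2]; simp
  · have h1 : reI ((3 : ℕ) : ZMod 4) = 0 := by decide
    have h2 : imI ((3 : ℕ) : ZMod 4) = -1 := by decide
    rw [h1, h2]; simp

theorem stdAddChar_three (b : ZMod 3) :
    ZMod.stdAddChar b = (constOmega b : ℂ) + linOmega b * zeta 3 := by
  obtain ⟨k, hk, rfl⟩ : ∃ k : ℕ, k < 3 ∧ (k : ZMod 3) = b := ⟨b.val, b.val_lt, by simp⟩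
  rw [stdAddChar_natCast]
  interval_cases k
  · simp [constOmega, linOmega]
  · have h1 : constOmega ((1 : ℕ) : ZMod 3) = 0 := by decide
    have h2 : linOmega ((1 : ℕ) : ZMod 3) = 1 := by decide
    rw [h1, h2]; simp
  · have h1 : constOmega ((2 : ℕ) : ZMod 3) = -1 := by decide
    have h2 : linOmega ((2 : ℕ) : ZMod 3) = -1 := by decide
    rw [zeta_three_sq, h1, h2]; push_cast; ring

/-- The vanishing of `∑ I ^ x * ω ^ y`, expressed in the basis `1`, `I`, `ω`, `I ω`. -/
def Vanishes (x : Fin 5 → ZMod 4) (y : Fin 5 → ZMod 3) : Prop :=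
  ∑ m, reI (x m) * constOmega (y m) = 0 ∧ ∑ m, imI (x m) * constOmega (y m) = 0 ∧
    ∑ m, reI (x m) * linOmega (y m) = 0 ∧ ∑ m, imI (x m) * linOmega (y m) = 0

/-- A vanishing sum of five products of a fourth and a third root of unity, by exponents. -/
def SumZero (x : Fin 5 → ZMod 4) (y : Fin 5 → ZMod 3) : Prop :=
  ∑ m, (ZMod.stdAddChar (x m) * ZMod.stdAddChar (y m) : ℂ) = 0

theorem SumZero.vanishes {x : Fin 5 → ZMod 4} {y : Fin 5 → ZMod 3} (h : SumZero x y) :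
    Vanishes x y := by
  have key := eq_zero_of_gaussian_add_gaussian_mul_zeta
    (α := ∑ m, reI (x m) * constOmega (y m)) (β := ∑ m, imI (x m) * constOmega (y m))
    (γ := ∑ m, reI (x m) * linOmega (y m)) (δ := ∑ m, imI (x m) * linOmega (y m)) ?_
  · exact key
  · unfold SumZero at h
    rw [← h]
    push_cast
    rw [Finset.sum_mul, ← Finset.sum_add_distrib, Finset.sum_mul, ← Finset.sum_add_distrib,
      Finset.sum_mul, ← Finset.sum_add_distrib]
    refine Finset.sum_congr rfl fun m _ => ?_
    rw [stdAddChar_four, stdAddChar_three]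
    ring

/-- The sum `∑ I ^ x` is divisible by `3` in the Gaussian integers. -/
def ThreeDvd (x : Fin 5 → ZMod 4) : Prop := 3 ∣ ∑ m, reI (x m) ∧ 3 ∣ ∑ m, imI (x m)

instance (x : Fin 5 → ZMod 4) : Decidable (ThreeDvd x) := by unfold ThreeDvd; infer_instance

/-- In the basis `1`, `ω` one has `1 = r + s + 3 t` for the coefficients `r`, `s` of a power of
`ω`, with `t = 1` at `ω²` and `t = 0` otherwise. -/
theorem Vanishes.threeDvd {x : Fin 5 → ZMod 4} {y : Fin 5 → ZMod 3} (h : Vanishes x y) :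
    ThreeDvd x := by
  have ht : ∀ b, (1 : ℤ) = constOmega b + linOmega b + 3 * if b = 2 then 1 else 0 := by decide
  have key : ∀ f : Fin 5 → ℤ, ∑ m, f m * constOmega (y m) = 0 → ∑ m, f m * linOmega (y m) = 0 →
      3 ∣ ∑ m, f m := by
    intro f h1 h2
    refine ⟨∑ m, f m * if y m = 2 then 1 else 0, ?_⟩
    have : ∑ m, f m = ∑ m, f m * constOmega (y m) + ∑ m, f m * linOmega (y m) +
        3 * ∑ m, f m * if y m = 2 then 1 else 0 := by
      rw [Finset.mul_sum, ← Finset.sum_add_distrib, ← Finset.sum_add_distrib]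
      refine Finset.sum_congr rfl fun m _ => ?_
      linear_combination f m * ht (y m)
    rw [this, h1, h2]; ring
  exact ⟨key _ h.1 h.2.2.1, key _ h.2.1 h.2.2.2⟩

/-- Exponents of `I` for the values `1, 1, 1, 1, -1`, with `-1` at `p`. -/
def oneFlip (p : Fin 5) : Fin 5 → ZMod 4 := fun m => if m = p then 2 else 0

/-- Exponents of `I` for the values `1, 1, 1, I, -I`, with `I` at `p` and `-I` at `q`. -/
def oppositePair (p q : Fin 5) : Fin 5 → ZMod 4 :=
  fun m => (if m = p then 1 else 0) - (if m = q then 1 else 0)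

/-- Five fourth roots of unity whose sum is divisible by `3` are, up to a common factor,
`1, 1, 1, 1, -1` or `1, 1, 1, I, -I`. -/
theorem ThreeDvd.shape : ∀ {x : Fin 5 → ZMod 4}, ThreeDvd x →
    ∃ u, (∃ p, x = fun m => u + oneFlip p m) ∨
      ∃ p q, p ≠ q ∧ x = fun m => u + oppositePair p q m := by
  decide +kernel

theorem not_threeDvd_oneFlip_sub : ∀ p q, ¬ ThreeDvd fun m => oneFlip p m - oneFlip q m := by
  decide +kernel

theorem not_threeDvd_oppositePair_sub_oneFlip :
    ∀ p q r, p ≠ q → ¬ ThreeDvd fun m => oppositePair p q m - oneFlip r m := by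
  decide +kernel

/-- If two rows with opposite pairs have an admissible quotient, then their pairs share the place
of `I`, or that of `-I`, and no other place. -/
theorem threeDvd_oppositePair_sub : ∀ {p q r s}, p ≠ q → r ≠ s →
    (ThreeDvd fun m => oppositePair p q m - oppositePair r s m) →
    (p = r ∧ q ≠ s) ∨ (q = s ∧ p ≠ r) := by
  decide +kernel

/-- The exponents of `ω` agree at `p` and `q` and are distinct at the three other places. -/
def PairTriple (y : Fin 5 → ZMod 3) (p q : Fin 5) : Prop :=
  y p = y q ∧ ∀ m n, m ≠ n → m ≠ p → m ≠ q → n ≠ p → n ≠ q → y m ≠ y n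

theorem PairTriple.symm {y : Fin 5 → ZMod 3} {p q : Fin 5} (h : PairTriple y p q) :
    PairTriple y q p :=
  ⟨h.1.symm, fun m n h1 h2 h3 h4 h5 => h.2 m n h1 h3 h2 h5 h4⟩

theorem exists_three_others {p q : Fin 5} (hpq : p ≠ q) : ∃ i j k : Fin 5,
    (p ≠ q ∧ p ≠ i ∧ p ≠ j ∧ p ≠ k) ∧ (q ≠ i ∧ q ≠ j ∧ q ≠ k) ∧ (i ≠ j ∧ i ≠ k) ∧ j ≠ k ∧
      (Finset.univ : Finset (Fin 5)) = {p, q, i, j, k} := by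
  revert p q; decide

/-- The two coordinates along `I` and `I ω` see only the opposite pair, the other two only the
three remaining places. -/
theorem pairTriple_of_vanishes {p q : Fin 5} {y : Fin 5 → ZMod 3} (hpq : p ≠ q)
    (h : Vanishes (oppositePair p q) y) : PairTriple y p q := by
  have h2 : ∀ b c : ZMod 3, constOmega b = constOmega c → linOmega b = linOmega c → b = c := by
    decide
  have h3 : ∀ a b c : ZMod 3, constOmega a + constOmega b + constOmega c = 0 →
      linOmega a + linOmega b + linOmega c = 0 → a ≠ b ∧ a ≠ c ∧ b ≠ c := by
    decide
  obtain ⟨i, j, k, hp, hq, hi, hj, huniv⟩ := exists_three_others hpq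
  have hsum : ∀ f : Fin 5 → ℤ, ∑ m, f m = f p + f q + f i + f j + f k := fun f => by
    rw [huniv, Finset.sum_insert (by simp [hp]), Finset.sum_insert (by simp [hq]),
      Finset.sum_insert (by simp [hi]), Finset.sum_pair hj]
    ring
  have xp : oppositePair p q p = 1 := by simp [oppositePair, hpq]
  have xq : oppositePair p q q = -1 := by simp [oppositePair, hpq.symm]
  have xo : ∀ m, p ≠ m → q ≠ m → oppositePair p q m = 0 := fun m h1 h2 => by
    simp [oppositePair, h1.symm, h2.symm]
  have hr : reI 1 = 0 ∧ reI (-1) = 0 ∧ reI 0 = 1 ∧ imI 1 = 1 ∧ imI (-1) = -1 ∧ imI 0 = 0 := by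
    decide
  obtain ⟨r1, r2, r3, i1, i2, i3⟩ := hr
  obtain ⟨e1, e2, e3, e4⟩ := h
  rw [hsum, xp, xq, xo i hp.2.1 hq.1, xo j hp.2.2.1 hq.2.1, xo k hp.2.2.2 hq.2.2] at e1 e2 e3 e4
  rw [r1, r2, r3] at e1 e3
  rw [i1, i2, i3] at e2 e4
  refine ⟨h2 _ _ (by linarith) (by linarith), ?_⟩
  obtain ⟨hij, hik, hjk⟩ := h3 (y i) (y j) (y k) (by linarith) (by linarith)
  have hmem : ∀ m, m ≠ p → m ≠ q → m = i ∨ m = j ∨ m = k := fun m h1 h2 => by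
    have := Finset.mem_univ m
    rw [huniv] at this
    simpa [h1, h2] using this
  intro m n hmn hmp hmq hnp hnq
  rcases hmem m hmp hmq with rfl | rfl | rfl <;> rcases hmem n hnp hnq with rfl | rfl | rfl <;>
    first | exact absurd rfl hmn | assumption | (apply Ne.symm; assumption)

theorem PairTriple.sum_eq {y : Fin 5 → ZMod 3} {p q : Fin 5} (hpq : p ≠ q)
    (h : PairTriple y p q) : ∑ m, y m = 2 * y p := by
  have h3 : ∀ a b c : ZMod 3, a ≠ b → a ≠ c → b ≠ c → a + b + c = 0 := by decide
  obtain ⟨i, j, k, ⟨-, hpi, hpj, hpk⟩, ⟨hqi, hqj, hqk⟩, ⟨hij, hik⟩, hjk, huniv⟩ :=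
    exists_three_others hpq
  have key := h3 (y i) (y j) (y k) (h.2 _ _ hij hpi.symm hqi.symm hpj.symm hqj.symm)
    (h.2 _ _ hik hpi.symm hqi.symm hpk.symm hqk.symm)
    (h.2 _ _ hjk hpj.symm hqj.symm hpk.symm hqk.symm)
  rw [huniv, Finset.sum_insert (by simp [hpq, hpi, hpj, hpk]),
    Finset.sum_insert (by simp [hqi, hqj, hqk]), Finset.sum_insert (by simp [hij, hik]),
    Finset.sum_pair hjk, ← h.1]
  linear_combination key

/-- Three exponent vectors of `ω` whose special pairs, and those of two of their differences, fit
together as they do for rows sharing the column `c`, do not exist: comparing coordinate sums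
modulo `3` shows that the first vector takes the same value at `q₂`, `q₃` and `c`. -/
theorem not_pairTriple_star {y₁ y₂ y₃ : Fin 5 → ZMod 3} {c q₁ q₂ q₃ : Fin 5}
    (h₁ : PairTriple y₁ c q₁) (h₂ : PairTriple y₂ c q₂) (h₃ : PairTriple y₃ c q₃)
    (h₁₂ : PairTriple (fun m => y₁ m - y₂ m) q₁ q₂)
    (h₁₃ : PairTriple (fun m => y₁ m - y₃ m) q₁ q₃)
    (hc₁ : c ≠ q₁) (hc₂ : c ≠ q₂) (hc₃ : c ≠ q₃) (hq₁₂ : q₁ ≠ q₂) (hq₁₃ : q₁ ≠ q₃)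
    (hq₂₃ : q₂ ≠ q₃) : False := by
  have h3 : (3 : ZMod 3) = 0 := by decide
  have key : ∀ {y : Fin 5 → ZMod 3} {q : Fin 5}, c ≠ q → q₁ ≠ q → PairTriple y c q →
      PairTriple (fun m => y₁ m - y m) q₁ q → y₁ q = y₁ c := by
    intro y q hc hq hy hyd
    have e1 := h₁.sum_eq hc₁
    have e2 := hy.sum_eq hc
    have e3 := hyd.sum_eq hq
    have e4 := h₁.1
    have e5 := hy.1
    have e6 := hyd.1
    simp only [Finset.sum_sub_distrib] at e3 e6
    linear_combination 2 * (e1 - e2 - e3 - 2 * e6 - 2 * e5) - (y₁ q - y₁ c) * h3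
  exact h₁.2 q₂ q₃ hq₂₃ hc₂.symm hq₁₂.symm hc₃.symm hq₁₃.symm
    ((key hc₂ hq₁₂ h₂ h₁₂).trans (key hc₃ hq₁₃ h₃ h₁₃).symm)

/-- A common factor `I ^ u` may be removed. -/
theorem SumZero.of_add {x x' : Fin 5 → ZMod 4} {y : Fin 5 → ZMod 3} (h : SumZero x' y)
    (u : ZMod 4) (hx : ∀ m, x' m = u + x m) : SumZero x y := by
  unfold SumZero at *
  have hu : (ZMod.stdAddChar u : ℂ) ≠ 0 := (AddChar.val_isUnit _ u).ne_zero
  suffices h0 : ZMod.stdAddChar u * ∑ m, (ZMod.stdAddChar (x m) * ZMod.stdAddChar (y m) : ℂ) = 0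
    from (mul_eq_zero.1 h0).resolve_left hu
  rw [← h, Finset.mul_sum]
  refine Finset.sum_congr rfl fun m _ => ?_
  rw [hx, AddChar.map_add_eq_mul, mul_assoc]

theorem SumZero.threeDvd {x : Fin 5 → ZMod 4} {y : Fin 5 → ZMod 3} (h : SumZero x y) :
    ThreeDvd x := h.vanishes.threeDvd

theorem exists_exponents_of_pow_twelve {z : ℂ} (hz : z ^ 12 = 1) :
    ∃ (a : ZMod 4) (b : ZMod 3), z = ZMod.stdAddChar a * ZMod.stdAddChar b := by
  obtain ⟨k, -, rfl⟩ := (isPrimitiveRoot_zeta (l := 12) (by norm_num)).eq_pow_of_pow_eq_one hz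
  refine ⟨k • (-1), k • 1, ?_⟩
  rw [AddChar.map_nsmul_eq_pow, AddChar.map_nsmul_eq_pow, ← mul_pow, AddChar.map_neg_eq_inv,
    stdAddChar_one, stdAddChar_one, zeta, zeta, zeta, ← Complex.exp_neg, ← Complex.exp_add]
  congr 2
  push_cast
  ring

/-- Relative to row `0`, every other row has the shape `1, 1, 1, I, -I` in its fourth-root part, and
any two of these rows share the place of `I` or that of `-I`.  Three such rows share one place, and
their cube-root parts are then contradictory. -/
theorem H_five_twelve_eq_empty : H 5 12 = ∅ := by
  refine Set.eq_empty_of_forall_notMem fun h hh => ?_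
  choose a b hab using fun i j => exists_exponents_of_pow_twelve (hh.2 i j)
  have hsum : ∀ i k, i ≠ k → SumZero (fun m => a i m - a k m) (fun m => b i m - b k m) := by
    intro i k hik
    unfold SumZero
    rw [← sum_mul_star hh hik]
    refine Finset.sum_congr rfl fun m _ => ?_
    rw [hab, hab k, ← stdAddChar_mul_star, ← stdAddChar_mul_star, star_mul']
    ring
  -- `u i` is the common factor in the fourth-root part of row `i` divided by row `0`; by `hdiff` it
  -- may be dropped when two such rows are compared.
  choose u hu using fun i : {i : Fin 5 // i ≠ 0} => (hsum i 0 i.2).threeDvd.shape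
  have hdiff : ∀ (i k : {i : Fin 5 // i ≠ 0}) (f g : Fin 5 → ZMod 4), i ≠ k →
      ((fun m => a i m - a 0 m) = fun m => u i + f m) →
      ((fun m => a k m - a 0 m) = fun m => u k + g m) →
      SumZero (fun m => f m - g m) (fun m => b i m - b k m) := by
    intro i k f g hik hf hg
    refine (hsum i k (by simpa [Subtype.ext_iff] using hik)).of_add (u i - u k) fun m => ?_
    have h1 : a i m - a 0 m = u i + f m := congrFun hf m
    have h2 : a k m - a 0 m = u k + g m := congrFun hg m
    linear_combination h1 - h2
  have hex : ∀ i : {i : Fin 5 // i ≠ 0}, ∃ k, i ≠ k := by decide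
  -- A single sign change is incompatible with either shape of any further row.
  have hpair : ∀ i : {i : Fin 5 // i ≠ 0}, ∃ p q, p ≠ q ∧
      (fun m => a i m - a 0 m) = fun m => u i + oppositePair p q m := by
    intro i
    rcases hu i with ⟨p, hp⟩ | hi
    · obtain ⟨k, hik⟩ := hex i
      rcases hu k with ⟨q, hq⟩ | ⟨q, r, hqr, hk⟩
      · exact absurd (hdiff i k _ _ hik hp hq).threeDvd (not_threeDvd_oneFlip_sub _ _)
      · exact absurd (hdiff k i _ _ hik.symm hk hp).threeDvd
          (not_threeDvd_oppositePair_sub_oneFlip _ _ _ hqr)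
    · exact hi
  choose p q hpq hp using hpair
  have hy : ∀ i : {i : Fin 5 // i ≠ 0}, PairTriple (fun m => b i m - b 0 m) (p i) (q i) := fun i =>
    pairTriple_of_vanishes (hpq i) ((hsum i 0 i.2).of_add (u i) (congrFun (hp i))).vanishes
  have hshare : ∀ i k, i ≠ k → (p i = p k ∧ q i ≠ q k) ∨ (q i = q k ∧ p i ≠ p k) := fun i k hik =>
    threeDvd_oppositePair_sub (hpq i) (hpq k) (hdiff i k _ _ hik (hp i) (hp k)).threeDvd
  -- The place shared by the pairs of two rows cancels in the quotient of the rows.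
  have hp' : ∀ i k, i ≠ k → p i = p k → q i ≠ q k →
      PairTriple (fun m => b i m - b 0 m - (b k m - b 0 m)) (q i) (q k) := by
    intro i k hik h1 h2
    have := hdiff i k _ _ hik (hp i) (hp k)
    have h3 : (fun m => oppositePair (p i) (q i) m - oppositePair (p k) (q k) m) =
        oppositePair (q k) (q i) := by
      funext m; simp only [oppositePair, h1]; ring
    rw [h3] at this
    simpa using (pairTriple_of_vanishes h2.symm this.vanishes).symm
  have hq' : ∀ i k, i ≠ k → q i = q k → p i ≠ p k →
      PairTriple (fun m => b i m - b 0 m - (b k m - b 0 m)) (p i) (p k) := by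
    intro i k hik h1 h2
    have := hdiff i k _ _ hik (hp i) (hp k)
    have h3 : (fun m => oppositePair (p i) (q i) m - oppositePair (p k) (q k) m) =
        oppositePair (p i) (p k) := by
      funext m; simp only [oppositePair, h1]; ring
    rw [h3] at this
    simpa using pairTriple_of_vanishes h2 this.vanishes
  let r₁ : {i : Fin 5 // i ≠ 0} := ⟨1, by decide⟩
  let r₂ : {i : Fin 5 // i ≠ 0} := ⟨2, by decide⟩
  let r₃ : {i : Fin 5 // i ≠ 0} := ⟨3, by decide⟩
  have n₁₂ : r₁ ≠ r₂ := by decide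
  have n₁₃ : r₁ ≠ r₃ := by decide
  have n₂₃ : r₂ ≠ r₃ := by decide
  have e₁ := hpq r₁
  have e₂ := hpq r₂
  have e₃ := hpq r₃
  have y₁ := hy r₁
  have y₂ := hy r₂
  have y₃ := hy r₃
  rcases hshare _ _ n₁₂ with ⟨h₁₂, k₁₂⟩ | ⟨h₁₂, k₁₂⟩
  · have h₁₃ : p r₁ = p r₃ ∧ q r₁ ≠ q r₃ ∧ q r₂ ≠ q r₃ := by
      have := hshare _ _ n₁₃
      have := hshare _ _ n₂₃
      grind
    rw [← h₁₂] at y₂ e₂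
    rw [← h₁₃.1] at y₃ e₃
    exact not_pairTriple_star y₁ y₂ y₃ (hp' _ _ n₁₂ h₁₂ k₁₂) (hp' _ _ n₁₃ h₁₃.1 h₁₃.2.1)
      e₁ e₂ e₃ k₁₂ h₁₃.2.1 h₁₃.2.2
  · have h₁₃ : q r₁ = q r₃ ∧ p r₁ ≠ p r₃ ∧ p r₂ ≠ p r₃ := by
      have := hshare _ _ n₁₃
      have := hshare _ _ n₂₃
      grind
    rw [← h₁₂] at y₂ e₂
    rw [← h₁₃.1] at y₃ e₃
    exact not_pairTriple_star y₁.symm y₂.symm y₃.symm (hq' _ _ n₁₂ h₁₂ k₁₂)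
      (hq' _ _ n₁₃ h₁₃.1 h₁₃.2.1) e₁.symm e₂.symm e₃.symm k₁₂ h₁₃.2.1 h₁₃.2.2

/-! ### Verification of the explicit matrices -/

/-- The second difference, with steps `u` and `v`, of the counting function of `e` vanishes.  It is
the coefficient vector of `(1 - ζ ^ u) * (1 - ζ ^ v) * ∑ j, ζ ^ e j`. -/
def CountsCancel {ι : Type*} [Fintype ι] (l : ℕ) (u v : ZMod l) (e : ι → ZMod l) : Prop :=
  ∀ k : ZMod l, ((Finset.univ.filter fun j => e j = k).card : ℤ) -
    (Finset.univ.filter fun j => e j + u = k).card -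
    (Finset.univ.filter fun j => e j + v = k).card +
    (Finset.univ.filter fun j => e j + (u + v) = k).card = 0

theorem sum_stdAddChar_eq_sum_card {ι : Type*} [Fintype ι] {l : ℕ} [NeZero l] (e : ι → ZMod l) :
    ∑ j, (ZMod.stdAddChar (e j) : ℂ) =
      ∑ k, ((Finset.univ.filter fun j => e j = k).card : ℂ) * ZMod.stdAddChar k := by
  rw [← Finset.sum_fiberwise_of_maps_to (t := Finset.univ) (g := e) (by simp)]
  refine Finset.sum_congr rfl fun k _ => ?_
  rw [Finset.sum_congr rfl (g := fun _ => (ZMod.stdAddChar k : ℂ))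
    (fun j hj => by rw [(Finset.mem_filter.1 hj).2])]
  simp

theorem one_sub_stdAddChar_ne_zero {l : ℕ} [NeZero l] {w : ZMod l} (hw : w ≠ 0) :
    1 - (ZMod.stdAddChar w : ℂ) ≠ 0 := fun h =>
  hw (ZMod.injective_stdAddChar (by rw [← sub_eq_zero.1 h, AddChar.map_zero_eq_one]))

theorem sum_stdAddChar_eq_zero {ι : Type*} [Fintype ι] {l : ℕ} [NeZero l] {u v : ZMod l}
    {e : ι → ZMod l} (hu : u ≠ 0) (hv : v ≠ 0) (he : CountsCancel l u v e) :
    ∑ j, (ZMod.stdAddChar (e j) : ℂ) = 0 := by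
  have hshift : ∀ w : ZMod l, (ZMod.stdAddChar w : ℂ) * ∑ j, (ZMod.stdAddChar (e j) : ℂ) =
      ∑ k, ((Finset.univ.filter fun j => e j + w = k).card : ℂ) * ZMod.stdAddChar k := fun w => by
    rw [← sum_stdAddChar_eq_sum_card, Finset.mul_sum]
    exact Finset.sum_congr rfl fun j _ => by rw [AddChar.map_add_eq_mul, mul_comm]
  have key : (1 - (ZMod.stdAddChar u : ℂ)) * (1 - ZMod.stdAddChar v) *
      ∑ j, (ZMod.stdAddChar (e j) : ℂ) = 0 := by
    have : (1 - (ZMod.stdAddChar u : ℂ)) * (1 - ZMod.stdAddChar v) *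
        ∑ j, (ZMod.stdAddChar (e j) : ℂ) = ∑ j, (ZMod.stdAddChar (e j) : ℂ) -
        ZMod.stdAddChar u * ∑ j, (ZMod.stdAddChar (e j) : ℂ) -
        ZMod.stdAddChar v * ∑ j, (ZMod.stdAddChar (e j) : ℂ) +
        ZMod.stdAddChar (u + v) * ∑ j, (ZMod.stdAddChar (e j) : ℂ) := by
      rw [AddChar.map_add_eq_mul]; ring
    rw [this, hshift, hshift, hshift, sum_stdAddChar_eq_sum_card, ← Finset.sum_sub_distrib,
      ← Finset.sum_sub_distrib, ← Finset.sum_add_distrib]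
    refine Finset.sum_eq_zero fun k _ => ?_
    rw [← sub_mul, ← sub_mul, ← add_mul]
    have := he k
    exact mul_eq_zero_of_left (by exact_mod_cast this) _
  exact (mul_eq_zero.1 key).resolve_left
    (mul_ne_zero (one_sub_stdAddChar_ne_zero hu) (one_sub_stdAddChar_ne_zero hv))

theorem zeta_pow_self {l : ℕ} (hl : l ≠ 0) (k : ℕ) : (zeta l ^ k) ^ l = 1 := by
  rw [← pow_mul, mul_comm, pow_mul, (isPrimitiveRoot_zeta hl).pow_eq_one, one_pow]

theorem norm_zeta_pow {l : ℕ} (hl : l ≠ 0) (k : ℕ) : ‖zeta l ^ k‖ = 1 :=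
  Complex.norm_eq_one_of_pow_eq_one (zeta_pow_self hl k) hl

/-- A finite criterion for the Hadamard property.  When every prime divisor of `l` is `p` or `q`, the
steps `u = l / p` and `v = l / q` are those for which it holds at every vanishing sum:
`(1 - X ^ u) * (1 - X ^ v)` is then divisible by all cyclotomic factors of `X ^ l - 1` except that
of index `l`. -/
theorem ofLog_mem_H {n l : ℕ} [NeZero l] {K : Matrix (Fin n) (Fin n) ℕ} (u v : ZMod l)
    (hu : u ≠ 0) (hv : v ≠ 0)
    (hK : ∀ i k, i < k → CountsCancel l u v fun j => (K i j : ZMod l) - (K k j : ZMod l)) :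
    ofLog l K ∈ H n l := by
  have hlt : ∀ i k, i < k → ofLog l K i ⬝ᵥ star (ofLog l K k) = 0 := ?_
  · refine ⟨⟨fun i j => norm_zeta_pow (NeZero.ne l) _, fun i k hik => ?_⟩,
      fun i j => zeta_pow_self (NeZero.ne l) _⟩
    rcases lt_or_gt_of_ne hik with h | h
    · exact hlt i k h
    · rw [Matrix.dotProduct_star, hlt k i h, star_zero]
  intro i k hik
  rw [← sum_stdAddChar_eq_zero hu hv (hK i k hik)]
  refine Finset.sum_congr rfl fun j _ => ?_
  simp only [ofLog, Matrix.of_apply, Pi.star_apply]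
  rw [← stdAddChar_natCast, ← stdAddChar_natCast, stdAddChar_mul_star]

theorem X9_10_mem_H : X9_10 ∈ H 9 10 :=
  ofLog_mem_H 5 2 (by decide) (by decide) (by unfold CountsCancel; decide +kernel)

theorem X10_4_mem_H : X10_4 ∈ H 10 4 :=
  ofLog_mem_H 2 2 (by decide) (by decide) (by unfold CountsCancel; decide +kernel)

theorem X10_5_mem_H : X10_5 ∈ H 10 5 :=
  ofLog_mem_H 1 1 (by decide) (by decide) (by unfold CountsCancel; decide +kernel)

theorem X10_6_mem_H : X10_6 ∈ H 10 6 :=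
  ofLog_mem_H 3 2 (by decide) (by decide) (by unfold CountsCancel; decide +kernel)

theorem tao_mem_H : tao ∈ H 6 3 := by
  have : tao = ofLog 3
      !![0, 0, 0, 0, 0, 0;
         0, 0, 1, 1, 2, 2;
         0, 1, 0, 2, 2, 1;
         0, 1, 2, 0, 1, 2;
         0, 2, 2, 1, 0, 1;
         0, 2, 1, 2, 1, 0] := by
    ext i j; fin_cases i <;> fin_cases j <;> simp [tao, ofLog]
  rw [this]
  exact ofLog_mem_H 1 1 (by decide) (by decide) (by unfold CountsCancel; decide +kernel)

theorem haagerup_mem_H : haagerup ∈ H 6 4 := by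
  have : haagerup = ofLog 4
      !![0, 0, 0, 0, 0, 0;
         0, 2, 1, 1, 3, 3;
         0, 1, 2, 3, 0, 2;
         0, 1, 3, 2, 2, 0;
         0, 3, 0, 2, 1, 2;
         0, 3, 2, 0, 2, 1] := by
    ext i j; fin_cases i <;> fin_cases j <;> simp [haagerup, ofLog, zeta_four]
  rw [this]
  exact ofLog_mem_H 2 2 (by decide) (by decide) (by unfold CountsCancel; decide +kernel)

theorem petrescu_mem_H : petrescu ∈ H 7 6 := by
  have : petrescu = ofLog 6
      !![0, 0, 0, 0, 0, 0, 0;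
         0, 1, 4, 5, 3, 3, 1;
         0, 4, 1, 3, 5, 3, 1;
         0, 5, 3, 1, 4, 1, 3;
         0, 3, 5, 4, 1, 1, 3;
         0, 3, 3, 1, 1, 4, 5;
         0, 1, 1, 3, 3, 5, 4] := by
    ext i j; fin_cases i <;> fin_cases j <;> simp [petrescu, ofLog]
  rw [this]
  exact ofLog_mem_H 3 2 (by decide) (by decide) (by unfold CountsCancel; decide +kernel)

theorem F_mem_H {n : ℕ} [NeZero n] : F n ∈ H n n := by
  refine ⟨⟨fun i j => norm_zeta_pow (NeZero.ne n) _, fun i k hik => ?_⟩,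
    fun i j => zeta_pow_self (NeZero.ne n) _⟩
  have hne : ((i : ℕ) : ZMod n) - ((k : ℕ) : ZMod n) ≠ 0 := fun h => hik <| by
    have h1 := (ZMod.natCast_eq_natCast_iff _ _ _).1 (sub_eq_zero.1 h)
    exact Fin.ext (Nat.ModEq.eq_of_lt_of_lt h1 i.2 k.2)
  have h1 : (zeta n ^ (i : ℕ) * star (zeta n ^ (k : ℕ))) =
      ZMod.stdAddChar (((i : ℕ) : ZMod n) - ((k : ℕ) : ZMod n)) := by
    rw [← stdAddChar_natCast, ← stdAddChar_natCast, stdAddChar_mul_star]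
  have h2 : F n i ⬝ᵥ star (F n k) =
      ∑ j ∈ Finset.range n, (zeta n ^ (i : ℕ) * star (zeta n ^ (k : ℕ))) ^ j := by
    rw [← Fin.sum_univ_eq_sum_range fun j => (zeta n ^ (i : ℕ) * star (zeta n ^ (k : ℕ))) ^ j]
    refine Finset.sum_congr rfl fun j _ => ?_
    simp only [F, Matrix.of_apply, Pi.star_apply, mul_pow, pow_mul, star_pow]
  rw [h2, h1]
  have h3 := mul_neg_geom_sum (ZMod.stdAddChar (((i : ℕ) : ZMod n) - ((k : ℕ) : ZMod n)) : ℂ) n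
  rw [← AddChar.map_nsmul_eq_pow, nsmul_eq_mul, ZMod.natCast_self, zero_mul,
    AddChar.map_zero_eq_one, sub_self] at h3
  exact (mul_eq_zero.1 h3).resolve_left (one_sub_stdAddChar_ne_zero hne)

theorem tensor_mem_H {m n l : ℕ} {A : Matrix (Fin m) (Fin m) ℂ} {B : Matrix (Fin n) (Fin n) ℂ}
    (hA : A ∈ H m l) (hB : B ∈ H n l) : tensor A B ∈ H (m * n) l := by
  have hrow : ∀ i j, tensor A B i j = A (finProdFinEquiv.symm i).1 (finProdFinEquiv.symm j).1 *
      B (finProdFinEquiv.symm i).2 (finProdFinEquiv.symm j).2 := fun i j => rfl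
  refine ⟨⟨fun i j => ?_, fun i k hik => ?_⟩, fun i j => ?_⟩
  · rw [hrow, norm_mul, hA.1.1, hB.1.1, one_mul]
  · have : tensor A B i ⬝ᵥ star (tensor A B k) =
        (∑ j, A (finProdFinEquiv.symm i).1 j * star (A (finProdFinEquiv.symm k).1 j)) *
        ∑ j, B (finProdFinEquiv.symm i).2 j * star (B (finProdFinEquiv.symm k).2 j) := by
      change ∑ j, tensor A B i j * star (tensor A B k j) = _
      rw [Finset.sum_mul_sum, ← Finset.sum_product', Finset.univ_product_univ,
        ← Equiv.sum_comp finProdFinEquiv]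
      refine Finset.sum_congr rfl fun j _ => ?_
      rw [hrow, hrow, Equiv.symm_apply_apply, star_mul']
      ring
    rw [this]
    have hne : (finProdFinEquiv.symm i) ≠ finProdFinEquiv.symm k :=
      fun h => hik (finProdFinEquiv.symm.injective h)
    by_cases h1 : (finProdFinEquiv.symm i).1 = (finProdFinEquiv.symm k).1
    · rw [sum_mul_star hB fun h2 => hne (Prod.ext h1 h2), mul_zero]
    · rw [sum_mul_star hA h1, zero_mul]
  · rw [hrow, mul_pow, hA.2, hB.2, one_mul]

/-! ### The Lam-Leung obstruction -/

theorem LamLeungObstruction.not_dvd {n l p : ℕ} (h : LamLeungObstruction n l) (hp : p.Prime)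
    (hpl : p ∣ l) : ¬ p ∣ n := by
  rintro ⟨c, rfl⟩
  refine h.2 ?_
  rw [mul_comm, ← smul_eq_mul]
  exact AddSubmonoid.nsmul_mem _ (AddSubmonoid.subset_closure
    (show p ∈ {q : ℕ | q.Prime ∧ q ∣ l} from ⟨hp, hpl⟩)) _

theorem LamLeungObstruction.odd_and_lt {n l p : ℕ} (h : LamLeungObstruction n l) (hp : p.Prime)
    (hp2 : p ≠ 2) (h2l : 2 ∣ l) (hpl : p ∣ l) : ¬ 2 ∣ n ∧ n < p := by
  have h2 := h.not_dvd Nat.prime_two h2l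
  refine ⟨h2, lt_of_not_ge fun hpn => h.2 ?_⟩
  obtain ⟨m, hm⟩ := hp.odd_of_ne_two hp2
  have hn : n = ((n - p) / 2) • 2 + p := by rw [smul_eq_mul]; omega
  rw [hn]
  exact add_mem
    (AddSubmonoid.nsmul_mem _ (AddSubmonoid.subset_closure
      (show 2 ∈ {q : ℕ | q.Prime ∧ q ∣ l} from ⟨Nat.prime_two, h2l⟩)) _)
    (AddSubmonoid.subset_closure (show p ∈ {q : ℕ | q.Prime ∧ q ∣ l} from ⟨hp, hpl⟩))

theorem lamLeungObstruction_prime_pow {n p b : ℕ} (hn : 2 ≤ n) (hp : p.Prime)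
    (hcop : (p ^ b).Coprime n) : LamLeungObstruction n (p ^ b) := by
  refine ⟨hn, fun hmem => ?_⟩
  rcases b with _ | b
  · have hle : AddSubmonoid.closure {q : ℕ | q.Prime ∧ q ∣ p ^ 0} ≤ ⊥ :=
      AddSubmonoid.closure_le.2 fun q hq => absurd hq.2 (by simpa using hq.1.ne_one)
    have := AddSubmonoid.mem_bot.1 (hle hmem)
    omega
  · have hle : AddSubmonoid.closure {q : ℕ | q.Prime ∧ q ∣ p ^ (b + 1)} ≤
        AddSubmonoid.multiples p :=
      AddSubmonoid.closure_le.2 fun q hq => by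
        rw [(Nat.prime_dvd_prime_iff_eq hq.1 hp).1 (hq.1.dvd_of_dvd_pow hq.2)]
        exact AddSubmonoid.mem_multiples p
    obtain ⟨c, rfl⟩ := (AddSubmonoid.mem_multiples_iff _ _).1 (hle hmem)
    have hp1 := hcop.coprime_dvd_left (dvd_pow_self p b.succ_ne_zero)
    exact hp.ne_one (hp1.eq_one_of_dvd (Dvd.intro_left c rfl))

/-- The even numbers and the numbers `≥ p` form a submonoid containing the prime divisors. -/
theorem lamLeungObstruction_two_mul_prime_pow {n p b : ℕ} (hn : 2 ≤ n) (hp : p.Prime)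
    (hodd : ¬ 2 ∣ n) (hnp : n < p) : LamLeungObstruction n (2 * p ^ b) := by
  refine ⟨hn, fun hmem => ?_⟩
  let S : AddSubmonoid ℕ :=
    { carrier := {k | 2 ∣ k ∨ p ≤ k}
      zero_mem' := Or.inl (dvd_zero 2)
      add_mem' := by
        rintro x y (hx | hx) (hy | hy)
        · exact Or.inl (dvd_add hx hy)
        all_goals exact Or.inr (by omega) }
  have hle : AddSubmonoid.closure {q : ℕ | q.Prime ∧ q ∣ 2 * p ^ b} ≤ S :=
    AddSubmonoid.closure_le.2 fun q hq => by
      rcases hq.1.dvd_mul.1 hq.2 with h | h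
      · rw [(Nat.prime_dvd_prime_iff_eq hq.1 Nat.prime_two).1 h]
        exact Or.inl (dvd_refl 2)
      · rw [(Nat.prime_dvd_prime_iff_eq hq.1 hp).1 (hq.1.dvd_of_dvd_pow h)]
        exact Or.inr le_rfl
  rcases hle hmem with h | h
  · exact hodd h
  · omega

theorem exists_eq_prime_pow {l : ℕ} (hl : 1 ≤ l) (hl14 : l ≤ 14) :
    (∃ p b, p.Prime ∧ l = p ^ b) ∨ l = 6 ∨ l = 10 ∨ l = 12 ∨ l = 14 := by
  interval_cases l <;> try omega
  · exact .inl ⟨2, 0, by norm_num, by norm_num⟩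
  · exact .inl ⟨2, 1, by norm_num, by norm_num⟩
  · exact .inl ⟨3, 1, by norm_num, by norm_num⟩
  · exact .inl ⟨2, 2, by norm_num, by norm_num⟩
  · exact .inl ⟨5, 1, by norm_num, by norm_num⟩
  · exact .inl ⟨7, 1, by norm_num, by norm_num⟩
  · exact .inl ⟨2, 3, by norm_num, by norm_num⟩
  · exact .inl ⟨3, 2, by norm_num, by norm_num⟩
  · exact .inl ⟨11, 1, by norm_num, by norm_num⟩
  · exact .inl ⟨13, 1, by norm_num, by norm_num⟩

theorem lamLeungObstruction_of_coprime {n l : ℕ} (hn : 2 ≤ n) (hl : 1 ≤ l) (hl14 : l ≤ 14)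
    (hcop : l.Coprime n) (h : l ≠ 6 ∧ l ≠ 10 ∧ l ≠ 12 ∧ l ≠ 14) : LamLeungObstruction n l := by
  obtain ⟨p, b, hp, rfl⟩ : ∃ p b, p.Prime ∧ l = p ^ b := by
    rcases exists_eq_prime_pow hl hl14 with h' | h'
    · exact h'
    · omega
  exact lamLeungObstruction_prime_pow hn hp hcop

theorem H_eq_empty_of_lamLeung {n l : ℕ} (hl : 1 ≤ l) (hl14 : l ≤ 14)
    (h : LamLeungObstruction n l) : H n l = ∅ := by
  have hn := h.1
  rcases exists_eq_prime_pow hl hl14 with ⟨p, b, hp, rfl⟩ | rfl | rfl | rfl | rfl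
  · rcases b with _ | b
    · exact H_eq_empty_of_one hn
    · exact H_eq_empty_of_prime_pow hn hp (h.not_dvd hp (dvd_pow_self p (by omega)))
  · have := h.odd_and_lt Nat.prime_three (by norm_num) (by norm_num) (by norm_num)
    omega
  · have := h.odd_and_lt Nat.prime_five (by norm_num) (by norm_num) (by norm_num)
    exact H_eq_empty_of_odd_of_lt (b := 0) hn Nat.prime_five this.1 this.2
  · have := h.odd_and_lt Nat.prime_three (by norm_num) (by norm_num) (by norm_num)
    omega
  · have := h.odd_and_lt (p := 7) (by norm_num) (by norm_num) (by norm_num) (by norm_num)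
    exact H_eq_empty_of_odd_of_lt (p := 7) (b := 0) hn (by norm_num) this.1 this.2

/-! ### Obstructed pairs in the range of the table -/

/-- Only the divisors of `12` need more than the Lam-Leung argument. -/
theorem H_eq_empty_of_haagerup {n l : ℕ} (hl : 1 ≤ l) (hl14 : l ≤ 14)
    (h : HaagerupObstruction n l) : H n l = ∅ := by
  obtain ⟨rfl, h5⟩ := h
  by_cases h12 : l ∣ 12
  · exact Set.subset_eq_empty (H_mono h12) H_five_twelve_eq_empty
  · by_cases h14 : l = 14
    · subst h14
      exact H_eq_empty_of_odd_of_lt (p := 7) (b := 0) (by norm_num) (by norm_num) (by norm_num)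
        (by norm_num)
    · refine H_eq_empty_of_lamLeung hl hl14 (lamLeungObstruction_of_coprime (by norm_num) hl hl14
        ?_ ?_)
      · exact ((Nat.Prime.coprime_iff_not_dvd Nat.prime_five).2 h5).symm
      · refine ⟨?_, ?_, ?_, h14⟩ <;> rintro rfl <;> omega

theorem H_eq_empty_of_obstructed {n l : ℕ} (hl : 1 ≤ l) (hl14 : l ≤ 14) (h : Obstructed n l) :
    H n l = ∅ := by
  rcases h with h | h | h | h | h | h
  · exact H_eq_empty_of_lamLeung hl hl14 h
  · exact H_eq_empty_of_deLauney (by omega) h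
  · exact H_eq_empty_of_haagerup hl hl14 h
  · exact H_eq_empty_of_sylvester h
  · exact H_eq_empty_of_sylvesterA h
  · exact H_eq_empty_of_sylvesterB h

theorem obstructed_of_coprime {n l : ℕ} (hn : 2 ≤ n) (hl : 1 ≤ l) (hl14 : l ≤ 14)
    (hcop : l.Coprime n) (h : l ≠ 6 ∧ l ≠ 10 ∧ l ≠ 12 ∧ l ≠ 14) : Obstructed n l :=
  .inl (lamLeungObstruction_of_coprime hn hl hl14 hcop h)

theorem obstructed_three_ten : Obstructed 3 10 :=
  .inl (lamLeungObstruction_two_mul_prime_pow (p := 5) (b := 1) (by norm_num) (by norm_num)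
    (by norm_num) (by norm_num))

theorem obstructed_three_fourteen : Obstructed 3 14 :=
  .inl (lamLeungObstruction_two_mul_prime_pow (p := 7) (b := 1) (by norm_num) (by norm_num)
    (by norm_num) (by norm_num))

theorem obstructed_two {n : ℕ} (hn : 3 ≤ n) (h4 : ¬ 4 ∣ n) : Obstructed n 2 :=
  .inr (.inr (.inr (.inl ⟨rfl, by omega, by omega, h4⟩)))

theorem obstructed_add_two {p : ℕ} (hp : p.Prime) (hp3 : 3 ≤ p) : Obstructed (p + 2) (2 * p) :=
  .inr (.inr (.inr (.inr (.inl ⟨p, 1, hp, hp3, le_rfl, rfl, by rw [pow_one]⟩))))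

theorem obstructed_two_mul {p q : ℕ} (hp : p.Prime) (hq : q.Prime) (hq3 : 3 ≤ q) (hqp : q < p) :
    Obstructed (2 * q) (2 * p) :=
  .inr (.inr (.inr (.inr (.inr ⟨p, q, 1, hp, hq, hq3, hqp, le_rfl, rfl, by rw [pow_one]⟩))))

/-! ### The table -/

theorem F22_mem_H : F22 ∈ H 4 2 := tensor_mem_H F_mem_H F_mem_H

theorem F222_mem_H : F222 ∈ H 8 2 := tensor_mem_H (tensor_mem_H F_mem_H F_mem_H) F_mem_H

theorem F33_mem_H : F33 ∈ H 9 3 := tensor_mem_H F_mem_H F_mem_H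

theorem explicitExample_mem_or_obstructed {n l : ℕ} (hn : 1 ≤ n) (hn10 : n ≤ 10) (hl : 1 ≤ l)
    (hl14 : l ≤ 14) :
    (∃ X, explicitExample n l = some X ∧ X ∈ H n l) ∨ Obstructed n l := by
  interval_cases n
  · exact .inl ⟨F 1, rfl, H_mono (one_dvd l) F_mem_H⟩
  · by_cases h2 : 2 ∣ l
    · exact .inl ⟨F 2, if_pos h2, H_mono h2 F_mem_H⟩
    · exact .inr (obstructed_of_coprime (by norm_num) hl hl14
        ((Nat.prime_two.coprime_iff_not_dvd).2 h2).symm (by omega))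
  · by_cases h3 : 3 ∣ l
    · exact .inl ⟨F 3, if_pos h3, H_mono h3 F_mem_H⟩
    · right
      by_cases h10 : l = 10
      · exact h10 ▸ obstructed_three_ten
      by_cases h14' : l = 14
      · exact h14' ▸ obstructed_three_fourteen
      exact obstructed_of_coprime (by norm_num) hl hl14
        ((Nat.prime_three.coprime_iff_not_dvd).2 h3).symm (by omega)
  · by_cases h2 : 2 ∣ l
    · exact .inl ⟨F22, if_pos h2, H_mono h2 F22_mem_H⟩
    · exact .inr (obstructed_of_coprime (by norm_num) hl hl14
        (((Nat.prime_two.coprime_iff_not_dvd).2 h2).symm.pow_right 2) (by omega))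
  · by_cases h5 : 5 ∣ l
    · exact .inl ⟨F 5, if_pos h5, H_mono h5 F_mem_H⟩
    · exact .inr (.inr (.inr (.inl ⟨rfl, h5⟩)))
  · by_cases h3 : 3 ∣ l
    · exact .inl ⟨tao, if_pos h3, H_mono h3 tao_mem_H⟩
    by_cases h4 : 4 ∣ l
    · exact .inl ⟨haagerup, (if_neg h3).trans (if_pos h4), H_mono h4 haagerup_mem_H⟩
    right
    by_cases h2 : l = 2
    · exact h2 ▸ obstructed_two (by norm_num) (by norm_num)
    by_cases h10 : l = 10
    · exact h10 ▸ obstructed_two_mul (p := 5) (q := 3) (by norm_num) (by norm_num) (by norm_num)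
        (by norm_num)
    by_cases h14' : l = 14
    · exact h14' ▸ obstructed_two_mul (p := 7) (q := 3) (by norm_num) (by norm_num) (by norm_num)
        (by norm_num)
    have h2' : ¬ 2 ∣ l := by omega
    exact obstructed_of_coprime (by norm_num) hl hl14
      (Nat.Coprime.mul_right (m := 2) (n := 3) ((Nat.prime_two.coprime_iff_not_dvd).2 h2').symm
        ((Nat.prime_three.coprime_iff_not_dvd).2 h3).symm) (by omega)
  · by_cases h6 : 6 ∣ l
    · exact .inl ⟨petrescu, if_pos h6, H_mono h6 petrescu_mem_H⟩
    by_cases h7 : 7 ∣ l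
    · exact .inl ⟨F 7, (if_neg h6).trans (if_pos h7), H_mono h7 F_mem_H⟩
    right
    by_cases h10 : l = 10
    · exact h10 ▸ obstructed_add_two (p := 5) (by norm_num) (by norm_num)
    exact obstructed_of_coprime (by norm_num) hl hl14
      (((by norm_num : Nat.Prime 7).coprime_iff_not_dvd).2 h7).symm (by omega)
  · by_cases h2 : 2 ∣ l
    · exact .inl ⟨F222, if_pos h2, H_mono h2 F222_mem_H⟩
    · exact .inr (obstructed_of_coprime (by norm_num) hl hl14
        (((Nat.prime_two.coprime_iff_not_dvd).2 h2).symm.pow_right 3) (by omega))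
  · by_cases h3 : 3 ∣ l
    · exact .inl ⟨F33, if_pos h3, H_mono h3 F33_mem_H⟩
    by_cases h10 : l = 10
    · subst h10
      exact .inl ⟨X9_10, rfl, X9_10_mem_H⟩
    right
    by_cases h14' : l = 14
    · exact h14' ▸ obstructed_add_two (p := 7) (by norm_num) (by norm_num)
    exact obstructed_of_coprime (by norm_num) hl hl14
      (((Nat.prime_three.coprime_iff_not_dvd).2 h3).symm.pow_right 2) (by omega)
  · by_cases h4 : 4 ∣ l
    · exact .inl ⟨X10_4, if_pos h4, H_mono h4 X10_4_mem_H⟩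
    by_cases h5 : l = 5
    · subst h5
      exact .inl ⟨X10_5, rfl, X10_5_mem_H⟩
    by_cases h6 : l = 6
    · subst h6
      exact .inl ⟨X10_6, rfl, X10_6_mem_H⟩
    by_cases h10 : l = 10
    · subst h10
      exact .inl ⟨F 10, rfl, F_mem_H⟩
    right
    by_cases h2 : l = 2
    · exact h2 ▸ obstructed_two (by norm_num) (by norm_num)
    by_cases h14' : l = 14
    · exact h14' ▸ obstructed_two_mul (p := 7) (q := 5) (by norm_num) (by norm_num) (by norm_num)
        (by norm_num)
    have h2' : ¬ 2 ∣ l := by omega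
    have h5' : ¬ 5 ∣ l := by omega
    exact obstructed_of_coprime (by norm_num) hl hl14
      (Nat.Coprime.mul_right (m := 2) (n := 5) ((Nat.prime_two.coprime_iff_not_dvd).2 h2').symm
        ((Nat.prime_five.coprime_iff_not_dvd).2 h5').symm) (by omega)

end Butson

theorem theorem7p10 (n l : ℕ) (hn : 1 ≤ n) (hn10 : n ≤ 10) (hl : 1 ≤ l) (hl14 : l ≤ 14) :
    ((∃ X, Butson.explicitExample n l = some X ∧ X ∈ Butson.H n l) ∨
      (Butson.H n l = ∅ ∧ Butson.Obstructed n l)) ∧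
    (Butson.Obstructed n l → Butson.H n l = ∅) :=
  ⟨(Butson.explicitExample_mem_or_obstructed hn hn10 hl hl14).imp_right fun h =>
    ⟨Butson.H_eq_empty_of_obstructed hl hl14 h, h⟩, Butson.H_eq_empty_of_obstructed hl hl14⟩
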